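/- **Setting.** Let $G$ be a finite connected simple graph on a vertex set $V$ with $n=|V|$ vertices, let $X_0$ be a random vertex of $G$ with an arbitrary distribution of non-zero entropy, and let $0<q\le \tfrac12$. The memoryless randomized algorithm $\mathcal A(q)$ starts an agent at $X_0$ and, in each round, independently of the past, terminates with probability $q$, remains at the current vertex with probability $\tfrac12$, and moves to a uniformly random neighbour of the current vertex with probability $\tfrac12-q$. Let $X_T$ be the vertex at which it terminates (it terminates with probability $1$). Write $H(X)=-\sum_x \Pr[X=x]\log \Pr[X=x]$ and $H(X|Y)=-\sum_y \Pr[Y=y]\sum_x \Pr[X=x|Y=y]\log\Pr[X=x|Y=y]$, with logarithms to base $2$. **Theorem.** The algorithm $\mathcal A(q)$ with $$q=\frac{f(n)}{n^3\log h(n)},\qquad f(n)=o(1),\quad h(n)=\omega\!\left(\max\{n^2,\,1/H(X_0)\}\right),$$ is well hiding for every connected graph and every distribution of the initial location $X_0$ with $H(X_0)>0$, that is, $H(X_0|X_T)/H(X_0)=1-o(1)$ as $n\to\infty$, uniformly over graphs and distributions. Precisely: let $f,r:\mathbb N\to\mathbb R$ satisfy $f(n)\to 0$ and $r(n)\to\infty$.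 Then there is a function $\varepsilon:\mathbb N\to\mathbb R$ with $\varepsilon(n)\to0$ such that for every $n$, every connected simple graph $G$ with $n$ vertices, every distribution of $X_0$ on the vertices with $H(X_0)>0$, every real $h\ge r(n)\max\{n^2,1/H(X_0)\}$, and $q=f(n)/(n^3\log h)$, if $0<q\le\frac12$ then the algorithm $\mathcal A(q)$ satisfies $$\left|\frac{H(X_0|X_T)}{H(X_0)}-1\right|\le \varepsilon(n).$$ -/

import Mathlib

open Filter Topology
open scoped ENNReal

/-- Shannon entropy `H(X)`, in bits, of a random variable `X` with law `p` on a finite set. -/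
noncomputable def entropy {α : Type*} [Fintype α] (p : PMF α) : ℝ :=
  -∑ a, (p a).toReal * Real.logb 2 (p a).toReal

/-- `Pr[Y = y]`, where `p` is the joint law of `(X, Y)`. -/
noncomputable def probSnd {α β : Type*} [Fintype α] (p : PMF (α × β)) (y : β) : ℝ :=
  ∑ x, (p (x, y)).toReal

/-- `Pr[X = x | Y = y]`, where `p` is the joint law of `(X, Y)`. -/
noncomputable def condProb {α β : Type*} [Fintype α] (p : PMF (α × β)) (x : α) (y : β) : ℝ :=
  (p (x, y)).toReal / probSnd p y

/-- Conditional Shannon entropy `H(X | Y)`, in bits, where `p` is the joint law of `(X, Y)`. -/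
noncomputable def condEntropy {α β : Type*} [Fintype α] [Fintype β] (p : PMF (α × β)) : ℝ :=
  -∑ y, probSnd p y * ∑ x, condProb p x y * Real.logb 2 (condProb p x y)

namespace HidingWalk

/-- What the agent may do in a round. -/
inductive Action
  | terminate
  | stay
  | move
  deriving DecidableEq

instance : Fintype Action where
  elems := {.terminate, .stay, .move}
  complete a := by cases a <;> decide

/-- The random choice made in one round of the algorithm `A(q)`: terminate with probability `q`,
remain with probability `1/2`, move with probability `1/2 - q`. -/
noncomputable def action (q : ℝ) (hq : q ∈ Set.Ioc (0 : ℝ) (1 / 2)) : PMF Action :=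
  PMF.ofFintype
    (fun a => match a with
      | .terminate => ENNReal.ofReal q
      | .stay => ENNReal.ofReal (1 / 2)
      | .move => ENNReal.ofReal (1 / 2 - q))
    (by
      have h1 : (Finset.univ : Finset Action) = {.terminate, .stay, .move} := rfl
      have h0 := hq.1
      have h2 := hq.2
      rw [h1, Finset.sum_insert (by decide), Finset.sum_insert (by decide), Finset.sum_singleton,
        ← ENNReal.ofReal_add (by norm_num) (by linarith),
        ← ENNReal.ofReal_add h0.le (by linarith)]
      rw [show q + (1 / 2 + (1 / 2 - q)) = 1 by ring, ENNReal.ofReal_one])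

/-- The state of the agent: its current vertex, and whether the algorithm is still running. -/
inductive State (V : Type*)
  | running (v : V)
  | stopped (v : V)

variable {V : Type*} [Fintype V]

open Classical in
/-- A uniformly random neighbour of `v` (and `v` itself if `v` has no neighbour). -/
noncomputable def randomNeighbor (G : SimpleGraph V) (v : V) : PMF V :=
  if h : (G.neighborFinset v).Nonempty then PMF.uniformOfFinset (G.neighborFinset v) h
  else PMF.pure v

/-- One round of the algorithm `A(q)` on the graph `G`; a stopped agent never changes its state. -/
noncomputable def round (G : SimpleGraph V) (q : ℝ) (hq : q ∈ Set.Ioc (0 : ℝ) (1 / 2)) :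
    State V → PMF (State V)
  | .stopped v => PMF.pure (.stopped v)
  | .running v => (action q hq).bind fun a =>
      match a with
      | .terminate => PMF.pure (.stopped v)
      | .stay => PMF.pure (.running v)
      | .move => (randomNeighbor G v).map .running

/-- The law of the state after `k` rounds, for an agent that starts at the vertex `x`. -/
noncomputable def stateAfter (G : SimpleGraph V) (q : ℝ) (hq : q ∈ Set.Ioc (0 : ℝ) (1 / 2))
    (x : V) : ℕ → PMF (State V)
  | 0 => PMF.pure (.running x)
  | k + 1 => (stateAfter G q hq x k).bind (round G q hq)

/-- `Pr[X_T = y | X_0 = x]`: the probability that the algorithm started at `x` ever stops at `y`,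
as the limit of the increasing probabilities that it has stopped at `y` within `k` rounds. -/
noncomputable def finalProb (G : SimpleGraph V) (q : ℝ) (hq : q ∈ Set.Ioc (0 : ℝ) (1 / 2))
    (x y : V) : ℝ≥0∞ :=
  ⨆ k, stateAfter G q hq x k (.stopped y)

/-- `State V` is a sum of two copies of `V`. -/
def stateEquiv (V : Type*) : V ⊕ V ≃ State V where
  toFun := Sum.elim .running .stopped
  invFun s := match s with
    | .running v => .inl v
    | .stopped v => .inr v
  left_inv s := by cases s <;> rfl
  right_inv s := by cases s <;> rfl

instance : Fintype (State V) := Fintype.ofEquiv _ (stateEquiv V)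

theorem sum_state (g : State V → ℝ≥0∞) :
    ∑ s, g s = ∑ v, g (.running v) + ∑ v, g (.stopped v) := by
  rw [← (stateEquiv V).sum_comp, Fintype.sum_sum_type]
  rfl

theorem total (G : SimpleGraph V) (q : ℝ) (hq : q ∈ Set.Ioc (0 : ℝ) (1 / 2)) (x : V) (k : ℕ) :
    ∑ v, stateAfter G q hq x k (.running v) + ∑ v, stateAfter G q hq x k (.stopped v) = 1 := by
  rw [← sum_state, ← tsum_fintype (L := SummationFilter.unconditional _)]
  exact PMF.tsum_coe _

theorem sum_action (g : Action → ℝ≥0∞) :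
    ∑ a, g a = g .terminate + (g .stay + g .move) := by
  have h1 : (Finset.univ : Finset Action) = {.terminate, .stay, .move} := rfl
  rw [h1, Finset.sum_insert (by decide), Finset.sum_insert (by decide), Finset.sum_singleton]

theorem round_running_stopped (G : SimpleGraph V) (q : ℝ) (hq : q ∈ Set.Ioc (0 : ℝ) (1 / 2))
    (v y : V) [Decidable (y = v)] :
    round G q hq (.running v) (.stopped y) = if y = v then ENNReal.ofReal q else 0 := by
  have hmap : ((randomNeighbor G v).map State.running) (State.stopped y) = 0 := by
    rw [PMF.map_apply]
    simp
  simp only [round, PMF.bind_apply, tsum_fintype, sum_action, hmap]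
  simp [action, PMF.pure_apply]

theorem stateAfter_succ_stopped (G : SimpleGraph V) (q : ℝ)
    (hq : q ∈ Set.Ioc (0 : ℝ) (1 / 2)) (x y : V) (k : ℕ) :
    stateAfter G q hq x (k + 1) (.stopped y) =
      stateAfter G q hq x k (.running y) * ENNReal.ofReal q
        + stateAfter G q hq x k (.stopped y) := by
  classical
  simp only [stateAfter, PMF.bind_apply, tsum_fintype, sum_state, round_running_stopped]
  simp [round, PMF.pure_apply]

theorem sum_running (G : SimpleGraph V) (q : ℝ) (hq : q ∈ Set.Ioc (0 : ℝ) (1 / 2))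
    (x : V) (k : ℕ) :
    ∑ v, stateAfter G q hq x k (.running v) = ENNReal.ofReal (1 - q) ^ k := by
  classical
  induction k with
  | zero => simp [stateAfter, PMF.pure_apply]
  | succ k ih =>
    have h1 := total G q hq x (k + 1)
    have h0 := total G q hq x k
    simp only [stateAfter_succ_stopped, Finset.sum_add_distrib, ← Finset.sum_mul, ih] at h1
    rw [ih] at h0
    have hS : ∑ v, stateAfter G q hq x k (.stopped v) ≠ ∞ := by
      intro h
      rw [h] at h0
      simp at h0
    have hP : ENNReal.ofReal (1 - q) ^ k * ENNReal.ofReal q ≠ ∞ :=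
      ENNReal.mul_ne_top (ENNReal.pow_ne_top ENNReal.ofReal_ne_top) ENNReal.ofReal_ne_top
    have hsplit : ENNReal.ofReal (1 - q) ^ (k + 1) + ENNReal.ofReal (1 - q) ^ k * ENNReal.ofReal q
        = ENNReal.ofReal (1 - q) ^ k := by
      rw [pow_succ, ← mul_add, ← ENNReal.ofReal_add (by linarith [hq.2]) hq.1.le]
      simp
    have h2 := h1.trans h0.symm
    rw [← add_assoc] at h2
    have h3 := (ENNReal.add_left_inj hS).1 h2
    exact (ENNReal.add_left_inj hP).1 (h3.trans hsplit.symm)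

theorem sum_finalProb (G : SimpleGraph V) (q : ℝ) (hq : q ∈ Set.Ioc (0 : ℝ) (1 / 2)) (x : V) :
    ∑ y, finalProb G q hq x y = 1 := by
  have hmono : ∀ y, Monotone fun k => stateAfter G q hq x k (.stopped y) := fun y =>
    monotone_nat_of_le_succ fun k => by
      rw [stateAfter_succ_stopped]
      exact le_add_self
  have hlim : Tendsto (fun k => ∑ y, stateAfter G q hq x k (.stopped y)) atTop
      (𝓝 (∑ y, finalProb G q hq x y)) :=
    tendsto_finsetSum _ fun y _ => tendsto_atTop_iSup (hmono y)
  have hrun : Tendsto (fun k => ∑ y, stateAfter G q hq x k (.running y)) atTop (𝓝 0) := by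
    simp only [sum_running]
    apply ENNReal.tendsto_pow_atTop_nhds_zero_of_lt_one
    rw [ENNReal.ofReal_lt_one]
    linarith [hq.1]
  have := hrun.add hlim
  simp only [total, zero_add] at this
  exact tendsto_nhds_unique this tendsto_const_nhds

/-- The law of the final location `X_T` of the algorithm started at the vertex `x`. -/
noncomputable def finalLaw (G : SimpleGraph V) (q : ℝ) (hq : q ∈ Set.Ioc (0 : ℝ) (1 / 2))
    (x : V) : PMF V :=
  PMF.ofFintype (finalProb G q hq x) (sum_finalProb G q hq x)

/-- The joint law of `(X_0, X_T)` when the initial location `X_0` has law `μ`. -/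
noncomputable def jointLaw (G : SimpleGraph V) (q : ℝ) (hq : q ∈ Set.Ioc (0 : ℝ) (1 / 2))
    (μ : PMF V) : PMF (V × V) :=
  μ.bind fun x => (finalLaw G q hq x).map fun y => (x, y)

end HidingWalk

/-! Let `P_x` be the law of `X_T` started at `x`, `D` the sum of all degrees and `n` the number of
vertices. Then `u = P_x / deg` is an electrical potential: its net flow out of `z`, times `1/2 - q`,
is `q` times (`1` if `z = x`, else `0`) minus `q * P_x z`. For `q ≤ 1/4` the flow out of any set is
at most `4q`, and superlevel sets of `u` turn this into a drop of at most `4q` along each edge.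
Paths have fewer than `n` edges and `D ≤ n ^ 2`, so `P_x` is within relative error `4 q n ^ 3` of
`deg / D` (`abs_toReal_finalLaw_sub_le`).

So the output law hardly depends on the input. A prior bounded below in entropy is not needed: the
gain `log (P_x y / ν y)`, with `ν` the law of `X_T`, is at most `δ (1 - μ x) ≤ -δ log (μ x)`, so the
information revealed is at most the fraction `δ` of `H(X_0)` (`one_sub_mul_entropy_le_condEntropy`).
Here `δ = 16 q n ^ 3`, which is at most `16 |f n|` once `log h ≥ 1`. -/

section ConditionalEntropy

/-! ### Conditional entropy of an input given the output of a channel -/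

variable {α β : Type*}

theorem PMF.toReal_apply_le_one (p : PMF α) (a : α) : (p a).toReal ≤ 1 :=
  ENNReal.toReal_le_of_le_ofReal zero_le_one (by simpa using p.coe_le_one a)

theorem PMF.toReal_bind_map_mk (μ : PMF α) (K : α → PMF β) (x : α) (y : β) :
    ((μ.bind fun x => (K x).map fun y => (x, y)) (x, y)).toReal
      = (μ x).toReal * (K x y).toReal := by
  classical
  rw [← ENNReal.toReal_mul, PMF.bind_apply, tsum_eq_single x, PMF.map_apply, tsum_eq_single y]
  · simp
  · intro b hb
    simp [hb.symm]
  · intro a ha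
    rw [PMF.map_apply]
    simp [ha.symm]

variable [Fintype α]

theorem probSnd_nonneg (p : PMF (α × β)) (y : β) : 0 ≤ probSnd p y :=
  Finset.sum_nonneg fun _ _ => ENNReal.toReal_nonneg

theorem toReal_le_probSnd (p : PMF (α × β)) (x : α) (y : β) :
    (p (x, y)).toReal ≤ probSnd p y :=
  Finset.single_le_sum (f := fun x => (p (x, y)).toReal) (fun _ _ => ENNReal.toReal_nonneg)
    (Finset.mem_univ x)

theorem probSnd_mul_condProb (p : PMF (α × β)) (x : α) (y : β) :
    probSnd p y * condProb p x y = (p (x, y)).toReal := by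
  by_cases h : probSnd p y = 0
  · have := toReal_le_probSnd p x y
    rw [h] at this ⊢
    rw [zero_mul]
    exact le_antisymm ENNReal.toReal_nonneg this
  · exact mul_div_cancel₀ _ h

theorem PMF.sum_toReal_eq_one (p : PMF α) : ∑ a, (p a).toReal = 1 := by
  rw [← ENNReal.toReal_sum fun a _ => p.apply_ne_top a, ← tsum_fintype (L := .unconditional _),
    p.tsum_coe, ENNReal.toReal_one]

/-- If all output laws are within the factors `1 ± η` of a common `π`, then each of them is at most
`1 + 4 η (1 - μ x)` times the law of the output. -/
theorem toReal_le_mul_probSnd (μ : PMF α) (K : α → PMF β) {π : β → ℝ} {η : ℝ}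
    (h0 : 0 ≤ η) (hη : η ≤ 1 / 2) (y : β)
    (hK : ∀ x, |(K x y).toReal - π y| ≤ η * π y) (x : α) :
    (K x y).toReal ≤ (1 + 4 * η * (1 - (μ x).toReal))
      * probSnd (μ.bind fun x => (K x).map fun y => (x, y)) y := by
  classical
  have hsum := PMF.sum_toReal_eq_one μ
  have hν : probSnd (μ.bind fun x => (K x).map fun y => (x, y)) y
      = ∑ x, (μ x).toReal * (K x y).toReal :=
    Finset.sum_congr rfl fun x _ => PMF.toReal_bind_map_mk μ K x y
  rw [hν]
  have hlow : (1 - η) * π y ≤ ∑ x, (μ x).toReal * (K x y).toReal := by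
    calc (1 - η) * π y = ∑ x, (μ x).toReal * ((1 - η) * π y) := by
          rw [← Finset.sum_mul, hsum, one_mul]
      _ ≤ _ := Finset.sum_le_sum fun x _ => mul_le_mul_of_nonneg_left
          (by linarith [(abs_le.1 (hK x)).1]) ENNReal.toReal_nonneg
  have hdiff : (K x y).toReal - ∑ z, (μ z).toReal * (K z y).toReal
      ≤ (1 - (μ x).toReal) * (2 * (η * π y)) := by
    calc (K x y).toReal - ∑ z, (μ z).toReal * (K z y).toReal
        = ∑ z, (μ z).toReal * ((K x y).toReal - (K z y).toReal) := by
          simp only [mul_sub, Finset.sum_sub_distrib, ← Finset.sum_mul, hsum, one_mul]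
      -- The term `z = x` vanishes, so the total weight left is `1 - μ x`, not `1`.
      _ ≤ ∑ z, ((μ z).toReal - if z = x then (μ x).toReal else 0) * (2 * (η * π y)) := by
          refine Finset.sum_le_sum fun z _ => ?_
          by_cases hz : z = x
          · simp [hz]
          · rw [if_neg hz, sub_zero]
            exact mul_le_mul_of_nonneg_left
              (by linarith [(abs_le.1 (hK x)).2, (abs_le.1 (hK z)).1]) ENNReal.toReal_nonneg
      _ = _ := by
          rw [← Finset.sum_mul, Finset.sum_sub_distrib, hsum]
          simp
  have hμ : 0 ≤ 1 - (μ x).toReal := sub_nonneg.2 (μ.toReal_apply_le_one x)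
  -- As `η ≤ 1/2`, `hlow` gives `π y ≤ 2 ν y`; this doubles the constant `2` to `4`.
  have hπ : η * π y ≤ 2 * η * ∑ x, (μ x).toReal * (K x y).toReal := by
    nlinarith [mul_le_mul_of_nonneg_left hlow h0, (abs_nonneg _).trans (hK x)]
  have := mul_le_mul_of_nonneg_left hπ hμ
  linarith

variable [Fintype β]

theorem condEntropy_eq_sum_log (p : PMF (α × β)) :
    condEntropy p
      = -(∑ x, ∑ y, (p (x, y)).toReal * Real.log (condProb p x y)) / Real.log 2 := by
  rw [condEntropy, neg_div, Finset.sum_comm, Finset.sum_div]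
  refine congrArg _ (Finset.sum_congr rfl fun y _ => ?_)
  rw [Finset.mul_sum, Finset.sum_div]
  refine Finset.sum_congr rfl fun x _ => ?_
  rw [← mul_assoc, probSnd_mul_condProb, Real.logb, mul_div_assoc]

theorem entropy_eq_sum_log (μ : PMF α) :
    entropy μ = -(∑ x, (μ x).toReal * Real.log (μ x).toReal) / Real.log 2 := by
  simp only [entropy, Real.logb, neg_div, Finset.sum_div, mul_div_assoc]

theorem condEntropy_nonneg (p : PMF (α × β)) : 0 ≤ condEntropy p := by
  rw [condEntropy_eq_sum_log]
  refine div_nonneg (neg_nonneg.2 ?_) (Real.log_nonneg one_le_two)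
  refine Finset.sum_nonpos fun x _ => Finset.sum_nonpos fun y _ => ?_
  refine mul_nonpos_of_nonneg_of_nonpos ENNReal.toReal_nonneg (Real.log_nonpos ?_ ?_)
  · exact div_nonneg ENNReal.toReal_nonneg (probSnd_nonneg p y)
  · exact div_le_one_of_le₀ (toReal_le_probSnd p x y) (probSnd_nonneg p y)

variable (μ : PMF α) (K : α → PMF β)

theorem sum_sum_mul_log (g : α → ℝ) :
    ∑ x, ∑ y, (μ x).toReal * (K x y).toReal * g x = ∑ x, (μ x).toReal * g x := by
  refine Finset.sum_congr rfl fun x _ => ?_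
  rw [← Finset.sum_mul, ← Finset.mul_sum, PMF.sum_toReal_eq_one, mul_one]

/-- Gibbs' inequality: `log t ≤ t - 1` at `t = ν y / K x y`, with correction terms that sum to zero
because `μ × ν` and the joint law both have mass one. -/
theorem condEntropy_le_entropy :
    condEntropy (μ.bind fun x => (K x).map fun y => (x, y)) ≤ entropy μ := by
  set p := μ.bind fun x => (K x).map fun y => (x, y) with hp
  rw [condEntropy_eq_sum_log, entropy_eq_sum_log]
  refine div_le_div_of_nonneg_right (neg_le_neg ?_) (Real.log_nonneg one_le_two)
  rw [← sum_sum_mul_log μ K]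
  have hν : ∑ y, probSnd p y = 1 := by
    simp only [probSnd]
    rw [Finset.sum_comm, ← Fintype.sum_prod_type (fun z : α × β => (p z).toReal),
      PMF.sum_toReal_eq_one]
  have key : ∀ x y, (μ x).toReal * (K x y).toReal * Real.log (μ x).toReal
      ≤ (p (x, y)).toReal * Real.log (condProb p x y)
        + ((μ x).toReal * probSnd p y - (μ x).toReal * (K x y).toReal) := by
    intro x y
    have hpxy : (p (x, y)).toReal = (μ x).toReal * (K x y).toReal := PMF.toReal_bind_map_mk μ K x y
    have hle := toReal_le_probSnd p x y
    rw [condProb, hpxy]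
    rw [hpxy] at hle
    rcases (ENNReal.toReal_nonneg (a := μ x)).eq_or_lt with h | hμ
    · simp [← h]
    rcases (ENNReal.toReal_nonneg (a := K x y)).eq_or_lt with h | hK
    · simp only [← h, mul_zero, zero_mul, zero_div, sub_zero, zero_add]
      exact mul_nonneg hμ.le (probSnd_nonneg p y)
    have hν : 0 < probSnd p y := (mul_pos hμ hK).trans_le hle
    have hlog := Real.log_le_sub_one_of_pos (div_pos hν hK)
    rw [Real.log_div hν.ne' hK.ne'] at hlog
    rw [Real.log_div (mul_pos hμ hK).ne' hν.ne', Real.log_mul hμ.ne' hK.ne']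
    have := mul_le_mul_of_nonneg_left hlog (mul_pos hμ hK).le
    have e : (μ x).toReal * (K x y).toReal * (probSnd p y / (K x y).toReal - 1)
        = (μ x).toReal * probSnd p y - (μ x).toReal * (K x y).toReal := by
      field_simp
    linarith
  refine (Finset.sum_le_sum fun x _ => Finset.sum_le_sum fun y _ => key x y).trans_eq ?_
  simp only [Finset.sum_add_distrib, Finset.sum_sub_distrib, ← Finset.mul_sum, hν,
    PMF.sum_toReal_eq_one, sub_self, add_zero]

/-- If every output law is, relative to the law of the output, at most `1 + δ (1 - μ x)`, then the
output reveals at most the fraction `δ` of the entropy of the input. -/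
theorem one_sub_mul_entropy_le_condEntropy {δ : ℝ} (hδ : 0 ≤ δ)
    (hK : ∀ x y, (K x y).toReal ≤ (1 + δ * (1 - (μ x).toReal))
      * probSnd (μ.bind fun x => (K x).map fun y => (x, y)) y) :
    (1 - δ) * entropy μ ≤ condEntropy (μ.bind fun x => (K x).map fun y => (x, y)) := by
  set p := μ.bind fun x => (K x).map fun y => (x, y) with hp
  rw [condEntropy_eq_sum_log, entropy_eq_sum_log, ← mul_div_assoc, mul_neg]
  refine div_le_div_of_nonneg_right (neg_le_neg ?_) (Real.log_nonneg one_le_two)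
  have key : ∀ x y, (p (x, y)).toReal * Real.log (condProb p x y)
      ≤ (μ x).toReal * (K x y).toReal * ((1 - δ) * Real.log (μ x).toReal) := by
    intro x y
    have hpxy : (p (x, y)).toReal = (μ x).toReal * (K x y).toReal := PMF.toReal_bind_map_mk μ K x y
    have hle := toReal_le_probSnd p x y
    rw [condProb, hpxy]
    rw [hpxy] at hle
    rcases (ENNReal.toReal_nonneg (a := μ x)).eq_or_lt with h | hμ
    · simp [← h]
    rcases (ENNReal.toReal_nonneg (a := K x y)).eq_or_lt with h | hKp
    · simp [← h]
    have hν : 0 < probSnd p y := (mul_pos hμ hKp).trans_le hle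
    refine mul_le_mul_of_nonneg_left ?_ (mul_pos hμ hKp).le
    rw [mul_div_assoc, Real.log_mul hμ.ne' (div_pos hKp hν).ne']
    have h1 := Real.log_le_sub_one_of_pos (div_pos hKp hν)
    have h2 := (div_le_iff₀ hν).2 (hK x y)
    -- Trades `δ (1 - μ x)` for `-δ log (μ x)`, making the loss proportional to the entropy.
    have h3 := mul_le_mul_of_nonneg_left (Real.log_le_sub_one_of_pos hμ) hδ
    linarith
  refine (Finset.sum_le_sum fun x _ => Finset.sum_le_sum fun y _ => key x y).trans_eq ?_
  rw [sum_sum_mul_log, Finset.mul_sum]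
  exact Finset.sum_congr rfl fun x _ => by ring

end ConditionalEntropy
-- Potentials and flows on a graph
section Potential

variable {V : Type*} [Fintype V] (G : SimpleGraph V) [DecidableRel G.Adj]

/-- If the net flow of the potential `u` out of every set is at most `c`, then so is the
potential difference along every edge. -/
theorem sub_le_of_adj_of_sum_flow_le (u : V → ℝ) {c : ℝ}
    (hflow : ∀ S : Finset V, ∑ y ∈ S, ∑ z ∈ G.neighborFinset y, (u y - u z) ≤ c)
    {a b : V} (hab : G.Adj a b) : u a - u b ≤ c := by
  classical
  rcases le_or_gt (u a) (u b) with h | h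
  -- The empty set gives `0 ≤ c`.
  · have := hflow ∅
    rw [Finset.sum_empty] at this
    linarith
  -- Every edge leaving this superlevel set carries nonnegative flow outwards, so the edge `ab`
  -- alone carries at most the total.
  set S := Finset.univ.filter fun y => u a ≤ u y with hS
  -- Flow between vertices of `S` cancels by antisymmetry.
  have hin : ∑ y ∈ S, ∑ z ∈ S, (if G.Adj y z then u y - u z else 0) = 0 := by
    have h1 : ∑ y ∈ S, ∑ z ∈ S, (if G.Adj y z then u y - u z else 0)
        = -∑ y ∈ S, ∑ z ∈ S, (if G.Adj y z then u y - u z else 0) := by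
      conv_lhs => rw [Finset.sum_comm]
      simp only [← Finset.sum_neg_distrib]
      refine Finset.sum_congr rfl fun y _ => Finset.sum_congr rfl fun z _ => ?_
      simp only [G.adj_comm z y]
      split_ifs <;> ring
    linarith
  have hsplit : ∑ y ∈ S, ∑ z ∈ G.neighborFinset y, (u y - u z)
      = ∑ y ∈ S, ∑ z ∈ Sᶜ, (if G.Adj y z then u y - u z else 0) := by
    rw [← (add_eq_right (b := ∑ y ∈ S, ∑ z ∈ Sᶜ, _)).2 hin, ← Finset.sum_add_distrib]
    refine Finset.sum_congr rfl fun y _ => ?_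
    rw [Finset.sum_add_sum_compl, ← Finset.sum_filter]
    congr 1
    ext z
    simp
  have hnn : ∀ y ∈ S, ∀ z ∈ Sᶜ, 0 ≤ if G.Adj y z then u y - u z else 0 := by
    intro y hy z hz
    simp only [hS, Finset.mem_filter, Finset.mem_univ, true_and, Finset.mem_compl, not_le] at hy hz
    split_ifs <;> linarith
  have ha : a ∈ S := by simp [hS]
  have hb : b ∈ Sᶜ := by simpa [hS] using h
  calc u a - u b = if G.Adj a b then u a - u b else 0 := by rw [if_pos hab]
    _ ≤ ∑ z ∈ Sᶜ, if G.Adj a z then u a - u z else 0 :=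
        Finset.single_le_sum (f := fun z => if G.Adj a z then u a - u z else 0) (hnn a ha) hb
    _ ≤ ∑ y ∈ S, ∑ z ∈ Sᶜ, if G.Adj y z then u y - u z else 0 :=
        Finset.single_le_sum (f := fun y => ∑ z ∈ Sᶜ, if G.Adj y z then u y - u z else 0)
          (fun y hy => Finset.sum_nonneg (hnn y hy)) ha
    _ ≤ c := hsplit ▸ hflow S

theorem SimpleGraph.Walk.sub_le_length_mul {V : Type*} {G : SimpleGraph V} (u : V → ℝ) {c : ℝ}
    (hu : ∀ a b, G.Adj a b → u a - u b ≤ c) {a b : V} (p : G.Walk a b) :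
    u a - u b ≤ p.length * c := by
  induction p with
  | nil => simp
  | cons h p ih =>
    have := hu _ _ h
    rw [SimpleGraph.Walk.length_cons]
    push_cast
    linarith

theorem SimpleGraph.Connected.sub_le_card_mul {V : Type*} [Fintype V] {G : SimpleGraph V}
    (hG : G.Connected) (u : V → ℝ) {c : ℝ} (hc : 0 ≤ c)
    (hu : ∀ a b, G.Adj a b → u a - u b ≤ c) (a b : V) :
    u a - u b ≤ Fintype.card V * c := by
  classical
  obtain ⟨p⟩ := hG.preconnected a b
  refine (SimpleGraph.Walk.sub_le_length_mul u hu (p.toPath : G.Walk a b)).trans ?_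
  exact mul_le_mul_of_nonneg_right (by exact_mod_cast p.toPath.2.length_lt.le) hc

theorem sum_degree_le_card_sq :
    ∑ v, (G.degree v : ℝ) ≤ (Fintype.card V : ℝ) ^ 2 := by
  calc ∑ v, (G.degree v : ℝ) ≤ ∑ _v : V, (Fintype.card V : ℝ) :=
        Finset.sum_le_sum fun v _ => by exact_mod_cast (G.degree_lt_card_verts v).le
    _ = _ := by simp [sq]

end Potential

/-! ### The law of the final vertex -/

namespace HidingWalk

variable {V : Type*} [Fintype V] (G : SimpleGraph V) (q : ℝ) (hq : q ∈ Set.Ioc (0 : ℝ) (1 / 2))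

theorem round_running_running (v y : V) [Decidable (y = v)] :
    round G q hq (.running v) (.running y)
      = (if y = v then ENNReal.ofReal (1 / 2) else 0)
        + ENNReal.ofReal (1 / 2 - q) * randomNeighbor G v y := by
  classical
  have hmap : ((randomNeighbor G v).map State.running) (State.running y)
      = randomNeighbor G v y := by
    rw [PMF.map_apply, tsum_eq_single y]
    · simp
    · intro z hz
      simp [hz.symm]
  simp only [round, PMF.bind_apply, tsum_fintype, sum_action, hmap]
  simp [action, PMF.pure_apply]

theorem stateAfter_succ_running (x y : V) (k : ℕ) :
    stateAfter G q hq x (k + 1) (.running y)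
      = ENNReal.ofReal (1 / 2) * stateAfter G q hq x k (.running y)
        + ENNReal.ofReal (1 / 2 - q)
          * ∑ z, stateAfter G q hq x k (.running z) * randomNeighbor G z y := by
  classical
  simp only [stateAfter, PMF.bind_apply, tsum_fintype, sum_state, round_running_running]
  simp [round, PMF.pure_apply, mul_add, Finset.sum_add_distrib, Finset.mul_sum, mul_left_comm]
  rw [mul_comm _ (2⁻¹ : ℝ≥0∞)]

/-- The stopped mass is `q` times the accumulated running mass, so summing the linear recursion of
the latter gives this one, with the start `x` as source. Its limit is the fixed-point equation
`finalProb_eq`. -/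
theorem stateAfter_succ_stopped_eq (x y : V) [Decidable (y = x)] (k : ℕ) :
    stateAfter G q hq x (k + 1) (.stopped y)
      = ENNReal.ofReal q * (if y = x then 1 else 0)
        + ENNReal.ofReal (1 / 2) * stateAfter G q hq x k (.stopped y)
        + ENNReal.ofReal (1 / 2 - q)
          * ∑ z, stateAfter G q hq x k (.stopped z) * randomNeighbor G z y := by
  induction k with
  | zero =>
    rw [stateAfter_succ_stopped]
    simp [stateAfter, PMF.pure_apply]
  | succ k ih =>
    rw [stateAfter_succ_stopped]
    conv_lhs => rw [ih, stateAfter_succ_running]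
    simp only [stateAfter_succ_stopped G q hq x _ k, add_mul, Finset.sum_add_distrib, mul_add]
    simp only [mul_right_comm _ (ENNReal.ofReal q), ← Finset.sum_mul]
    ring

theorem tendsto_stateAfter_stopped (x y : V) :
    Tendsto (fun k => stateAfter G q hq x k (.stopped y)) atTop (𝓝 (finalProb G q hq x y)) :=
  tendsto_atTop_iSup <| monotone_nat_of_le_succ fun k => by
    rw [stateAfter_succ_stopped]
    exact le_add_self

theorem finalProb_eq (x y : V) [Decidable (y = x)] :
    finalProb G q hq x y
      = ENNReal.ofReal q * (if y = x then 1 else 0)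
        + ENNReal.ofReal (1 / 2) * finalProb G q hq x y
        + ENNReal.ofReal (1 / 2 - q) * ∑ z, finalProb G q hq x z * randomNeighbor G z y := by
  have h := (tendsto_stateAfter_stopped G q hq x y).comp (tendsto_add_atTop_nat 1)
  simp only [Function.comp_def, stateAfter_succ_stopped_eq] at h
  refine tendsto_nhds_unique h ((tendsto_const_nhds.add ?_).add ?_)
  · exact ENNReal.Tendsto.const_mul (tendsto_stateAfter_stopped G q hq x y)
      (Or.inr ENNReal.ofReal_ne_top)
  · refine ENNReal.Tendsto.const_mul (tendsto_finsetSum _ fun z _ => ?_)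
      (Or.inr ENNReal.ofReal_ne_top)
    exact ENNReal.Tendsto.mul_const (tendsto_stateAfter_stopped G q hq x z)
      (Or.inr ((randomNeighbor G z).apply_ne_top y))

theorem toReal_randomNeighbor [DecidableRel G.Adj] {z : V} (hz : G.degree z ≠ 0) (y : V) :
    (randomNeighbor G z y).toReal = if G.Adj y z then (G.degree z : ℝ)⁻¹ else 0 := by
  classical
  have hne : (G.neighborFinset z).Nonempty := Finset.card_ne_zero.1 hz
  rw [randomNeighbor]
  split_ifs with h1 h2 h2
  · rw [PMF.uniformOfFinset_apply, if_pos (by simpa using h2.symm), ENNReal.toReal_inv,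
      ENNReal.toReal_natCast, ← G.card_neighborFinset_eq_degree]
    congr!
  · rw [PMF.uniformOfFinset_apply, if_neg (by simpa using fun h => h2 (G.adj_symm h)),
      ENNReal.toReal_zero]
  all_goals exact absurd (by convert hne) h1

theorem toReal_finalLaw_eq [DecidableRel G.Adj] (hdeg : ∀ z, G.degree z ≠ 0) (x y : V)
    [Decidable (y = x)] :
    (finalLaw G q hq x y).toReal
      = q * (if y = x then 1 else 0) + 1 / 2 * (finalLaw G q hq x y).toReal
        + (1 / 2 - q) * ∑ z ∈ G.neighborFinset y,
          (finalLaw G q hq x z).toReal / (G.degree z : ℝ) := by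
  have hfin : ∀ z, finalProb G q hq x z ≠ ∞ := fun z => (finalLaw G q hq x).apply_ne_top z
  have hmul : ∀ z, finalProb G q hq x z * randomNeighbor G z y ≠ ∞ := fun z =>
    ENNReal.mul_ne_top (hfin z) ((randomNeighbor G z).apply_ne_top y)
  have h := congrArg ENNReal.toReal (finalProb_eq G q hq x y)
  have hq0 := hq.1.le
  have hq2 : 0 ≤ 1 / 2 - q := sub_nonneg.2 hq.2
  rw [ENNReal.toReal_add, ENNReal.toReal_add, ENNReal.toReal_mul, ENNReal.toReal_mul,
    ENNReal.toReal_mul, ENNReal.toReal_ofReal hq0, ENNReal.toReal_ofReal (by norm_num),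
    ENNReal.toReal_ofReal hq2, ENNReal.toReal_sum fun z _ => hmul z] at h
  · simp only [ENNReal.toReal_mul, toReal_randomNeighbor G (hdeg _)] at h
    simp only [finalLaw, PMF.ofFintype_apply]
    refine h.trans ?_
    congr 2
    · congr 1
      split_ifs <;> simp
    · rw [SimpleGraph.neighborFinset_eq_filter, Finset.sum_filter]
      refine Finset.sum_congr rfl fun z _ => ?_
      split_ifs <;> simp [div_eq_mul_inv]
  · exact ENNReal.mul_ne_top ENNReal.ofReal_ne_top (by split_ifs <;> simp)
  · exact ENNReal.mul_ne_top ENNReal.ofReal_ne_top (hfin y)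
  · exact ENNReal.add_ne_top.2 ⟨ENNReal.mul_ne_top ENNReal.ofReal_ne_top (by split_ifs <;> simp),
      ENNReal.mul_ne_top ENNReal.ofReal_ne_top (hfin y)⟩
  · exact ENNReal.mul_ne_top ENNReal.ofReal_ne_top (ENNReal.sum_ne_top.2 fun z _ => hmul z)

/-- The law of the final location is, pointwise and relatively, `4 q n ^ 3`-close to the stationary
distribution of the random walk. -/
theorem abs_toReal_finalLaw_sub_le [DecidableRel G.Adj] [Nontrivial V] (hG : G.Connected)
    (hq4 : q ≤ 1 / 4) (x y : V) :
    |(finalLaw G q hq x y).toReal - G.degree y / ∑ v, (G.degree v : ℝ)|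
      ≤ 4 * q * (Fintype.card V : ℝ) ^ 3 * (G.degree y / ∑ v, (G.degree v : ℝ)) := by
  classical
  have hpos : ∀ z, (0 : ℝ) < G.degree z := fun z => by
    exact_mod_cast hG.preconnected.degree_pos_of_nontrivial z
  have hdeg : ∀ z, G.degree z ≠ 0 := fun z => by exact_mod_cast (hpos z).ne'
  have hq0 := hq.1
  set D : ℝ := ∑ v, (G.degree v : ℝ) with hD
  have hDpos : 0 < D := Finset.sum_pos (fun v _ => hpos v) Finset.univ_nonempty
  set u : V → ℝ := fun z => (finalLaw G q hq x z).toReal / G.degree z with hu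
  have hdu : ∀ z, G.degree z * u z = (finalLaw G q hq x z).toReal := fun z =>
    mul_div_cancel₀ _ (hpos z).ne'
  have hnet : ∀ z, (1 / 2 - q) * ∑ w ∈ G.neighborFinset z, (u z - u w)
      = q * ((if z = x then 1 else 0) - (finalLaw G q hq x z).toReal) := by
    intro z
    have h := toReal_finalLaw_eq G q hq hdeg x z
    rw [Finset.sum_sub_distrib, Finset.sum_const, G.card_neighborFinset_eq_degree, nsmul_eq_mul,
      hdu]
    simp only [hu]
    linarith
  -- The source supplies at most `q` and stopping only absorbs flow; dividing by `1/2 - q ≥ 1/4`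
  -- gives `4q`.
  have hflow : ∀ S : Finset V, ∑ z ∈ S, ∑ w ∈ G.neighborFinset z, (u z - u w) ≤ 4 * q := by
    intro S
    have h1 : (1 / 2 - q) * ∑ z ∈ S, ∑ w ∈ G.neighborFinset z, (u z - u w) ≤ q := by
      rw [Finset.mul_sum, Finset.sum_congr rfl fun z _ => hnet z, ← Finset.mul_sum]
      refine mul_le_of_le_one_right hq0.le ?_
      rw [Finset.sum_sub_distrib, Finset.sum_ite_eq']
      have : 0 ≤ ∑ z ∈ S, (finalLaw G q hq x z).toReal :=
        Finset.sum_nonneg fun _ _ => ENNReal.toReal_nonneg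
      split_ifs <;> linarith
    nlinarith
  have hosc : ∀ a b, u a - u b ≤ Fintype.card V * (4 * q) :=
    hG.sub_le_card_mul u (by positivity) fun a b => sub_le_of_adj_of_sum_flow_le G u hflow
  have hsum : ∑ z, G.degree z * u z = 1 := by
    simp only [hdu, PMF.sum_toReal_eq_one]
  have hDu : |D * u y - 1| ≤ D * (Fintype.card V * (4 * q)) := by
    -- Since `∑ deg z * u z = 1`, the error is a degree-weighted sum of potential differences.
    have e : D * u y - 1 = ∑ z, G.degree z * (u y - u z) := by
      simp only [mul_sub, Finset.sum_sub_distrib, hsum, ← Finset.sum_mul, hD]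
    rw [e, hD, Finset.sum_mul]
    refine (Finset.abs_sum_le_sum_abs _ _).trans (Finset.sum_le_sum fun z _ => ?_)
    rw [abs_mul, abs_of_pos (hpos z)]
    exact mul_le_mul_of_nonneg_left (abs_le.2 ⟨by linarith [hosc z y], hosc y z⟩) (hpos z).le
  have hbound : D * (Fintype.card V * (4 * q)) ≤ 4 * q * (Fintype.card V : ℝ) ^ 3 := by
    have := mul_le_mul_of_nonneg_right (sum_degree_le_card_sq G)
      (by positivity : (0 : ℝ) ≤ Fintype.card V * (4 * q))
    calc _ ≤ _ := this
      _ = _ := by ring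
  have e : (finalLaw G q hq x y).toReal - G.degree y / D = (D * u y - 1) * (G.degree y / D) := by
    rw [← hdu]
    field_simp
  rw [e, abs_mul, abs_of_pos (div_pos (hpos y) hDpos)]
  exact mul_le_mul_of_nonneg_right (hDu.trans hbound) (div_pos (hpos y) hDpos).le

theorem abs_condEntropy_div_entropy_sub_one_le_one (μ : PMF V) (hμ : 0 < entropy μ) :
    |condEntropy (jointLaw G q hq μ) / entropy μ - 1| ≤ 1 := by
  have h0 := div_nonneg (condEntropy_nonneg (jointLaw G q hq μ)) hμ.le
  have h1 := div_le_one_of_le₀ (condEntropy_le_entropy μ (finalLaw G q hq)) hμ.le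
  rw [jointLaw] at *
  exact abs_le.2 ⟨by linarith, by linarith⟩

theorem abs_condEntropy_div_entropy_sub_one_le [Nontrivial V] (hG : G.Connected) (μ : PMF V)
    (hμ : 0 < entropy μ) (hsmall : q * (Fintype.card V : ℝ) ^ 3 ≤ 1 / 8) :
    |condEntropy (jointLaw G q hq μ) / entropy μ - 1| ≤ 16 * (q * (Fintype.card V : ℝ) ^ 3) := by
  classical
  have hq0 := hq.1
  have hn : (1 : ℝ) ≤ (Fintype.card V : ℝ) ^ 3 :=
    one_le_pow₀ (by exact_mod_cast Fintype.card_pos)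
  have hη : 0 ≤ 4 * q * (Fintype.card V : ℝ) ^ 3 := by positivity
  have hlow := one_sub_mul_entropy_le_condEntropy μ (finalLaw G q hq)
    (δ := 4 * (4 * q * (Fintype.card V : ℝ) ^ 3)) (by positivity) fun x y =>
      toReal_le_mul_probSnd μ (finalLaw G q hq)
        (π := fun y => G.degree y / ∑ v, (G.degree v : ℝ)) hη (by linarith) y
        (fun x => abs_toReal_finalLaw_sub_le G q hq hG (by nlinarith) x y) x
  have h0 := (le_div_iff₀ hμ).2 hlow
  have h1 := div_le_one_of_le₀ (condEntropy_le_entropy μ (finalLaw G q hq)) hμ.le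
  rw [jointLaw]
  exact abs_le.2 ⟨by linarith, by linarith⟩

end HidingWalk

theorem mainTheorem1 (f r : ℕ → ℝ) (hf : Tendsto f atTop (𝓝 0)) (hr : Tendsto r atTop atTop) :
    ∃ ε : ℕ → ℝ, Tendsto ε atTop (𝓝 0) ∧
      ∀ (V : Type*) [Fintype V] (G : SimpleGraph V) (_ : G.Connected)
        (μ : PMF V) (_ : 0 < entropy μ)
        (h : ℝ) (_ : r (Fintype.card V) * max ((Fintype.card V : ℝ) ^ 2) (1 / entropy μ) ≤ h)
        (q : ℝ) (hq : q ∈ Set.Ioc (0 : ℝ) (1 / 2))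
        (_ : q = f (Fintype.card V) / ((Fintype.card V : ℝ) ^ 3 * Real.logb 2 h)),
        |condEntropy (HidingWalk.jointLaw G q hq μ) / entropy μ - 1| ≤ ε (Fintype.card V) := by
  classical
  -- The value `1` is the trivial bound from `0 ≤ H(X_0|X_T) ≤ H(X_0)`, used where `n` is too small.
  -- The condition `2 ≤ r n` forces `h ≥ 2`, hence `log h ≥ 1`; `|f n| ≤ 1/8` keeps the relative
  -- error `4 q n ^ 3` below `1/2`.
  refine ⟨fun n => if 2 ≤ n ∧ 2 ≤ r n ∧ |f n| ≤ 1 / 8 then 16 * |f n| else 1, ?_, ?_⟩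
  · have hlim : Tendsto (fun n => 16 * |f n|) atTop (𝓝 0) := by
      simpa using hf.abs.const_mul 16
    refine hlim.congr' ?_
    have hf' : ∀ᶠ n in atTop, |f n| ≤ 1 / 8 :=
      (by simpa using hf.abs : Tendsto (fun n => |f n|) atTop (𝓝 0)).eventually_le_const
        (by norm_num)
    filter_upwards [eventually_ge_atTop 2, hr.eventually_ge_atTop 2, hf'] with n h1 h2 h3
    rw [if_pos ⟨h1, h2, h3⟩]
  intro V _ G hG μ hμ h hh q hq hqf
  dsimp only
  split_ifs with hn
  swap
  · exact HidingWalk.abs_condEntropy_div_entropy_sub_one_le_one G q hq μ hμ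
  obtain ⟨hn, hrn, hfn⟩ := hn
  have : Nontrivial V := Fintype.one_lt_card_iff_nontrivial.1 hn
  have hn1 : (1 : ℝ) ≤ Fintype.card V := by exact_mod_cast one_le_two.trans hn
  have h2 : 2 ≤ h := by
    have h1 : (1 : ℝ) ≤ max ((Fintype.card V : ℝ) ^ 2) (1 / entropy μ) :=
      (one_le_pow₀ hn1).trans (le_max_left _ _)
    nlinarith
  have hlog : 1 ≤ Real.logb 2 h := by
    rwa [Real.le_logb_iff_rpow_le one_lt_two (by linarith), Real.rpow_one]
  have hqn : q * (Fintype.card V : ℝ) ^ 3 ≤ |f (Fintype.card V)| := by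
    have e : q * (Fintype.card V : ℝ) ^ 3 * Real.logb 2 h = f (Fintype.card V) := by
      rw [hqf]
      field_simp
    have hp : 0 ≤ q * (Fintype.card V : ℝ) ^ 3 := mul_nonneg hq.1.le (by positivity)
    calc q * (Fintype.card V : ℝ) ^ 3 ≤ q * (Fintype.card V : ℝ) ^ 3 * Real.logb 2 h :=
          le_mul_of_one_le_right hp hlog
      _ ≤ |f (Fintype.card V)| := e ▸ le_abs_self _
  exact (HidingWalk.abs_condEntropy_div_entropy_sub_one_le G q hq hG μ hμ (hqn.trans hfn)).trans
    (by linarith)
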